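/- For $x=(x_1,\dots,x_n)$ and $\lambda=(\lambda_1,\dots,\lambda_n)$ a partition (weakly decreasing non-negative integers) or a half-partition (weakly decreasing positive elements of $\mathbb{Z}+\tfrac12$), let $$\mathrm{so}^{\pm}_{2n+1,\lambda}(x):=\frac{\det_{1\le i,j\le n}\big(x_i^{\lambda_j+n-j+1/2}\pm x_i^{-(\lambda_j+n-j+1/2)}\big)}{\det_{1\le i,j\le n}\big(x_i^{n-j+1/2}\pm x_i^{-(n-j+1/2)}\big)},\qquad \mathrm{so}_{2n+1,\lambda}(x):=\mathrm{so}^{-}_{2n+1,\lambda}(x).$$ Let $n,r$ be non-negative integers, $\varepsilon\in\{-1,1\}$ and $s:=r/2$. Then $$\sum_{\lambda\subseteq(r^n)}\varepsilon^{|\lambda|}\,\mathrm{so}_{2n+1,\lambda}(\varepsilon x)=\mathrm{so}_{2n+1,(s^n)}(x)\,\mathrm{so}^{\sigma}_{2n+1,(s^n)}(x),$$ where the sum is over all partitions $\lambda=(\lambda_1,\dots,\lambda_n)$ with $r\ge\lambda_1\ge\cdots\ge\lambda_n\ge 0$, $|\lambda|=\lambda_1+\cdots+\lambda_n$, and $\sigma=-$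 if $\varepsilon=1$ and $\sigma=+$ if $\varepsilon=-1$. Here $x_1,\dots,x_n$ may be indeterminates or, more generally, elements of any field $K$ such that $x_i\ne0$, $x_i\ne1$, $x_i\neq\varepsilon$ for all $i$, and $x_i\ne x_j$, $x_ix_j\ne1$ for all $i\ne j$; under these conditions all the denominators above are non-zero. The half-integer powers are taken with respect to square roots $y_i$ of $x_i$ (in both factors on the right) and $z_i$ of $\varepsilon x_i$ (on the left) in $K$, and the identity holds for every choice of such square roots. -/

import Mathlib

namespace OddOrthogonal

/-- The partitions contained in the rectangle `(r ^ n)`, as weakly decreasing sequences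
`(lam 0, ..., lam (n - 1))` of natural numbers, each at most `r`. -/
noncomputable def partitionsInBox (n r : ℕ) : Finset (Fin n → ℕ) :=
  open Classical in
  (Fintype.piFinset fun _ : Fin n => Finset.range (r + 1)).filter fun lam => Antitone lam

/-- `det (x_i ^ (λ_j + n - j + 1/2) + c * x_i ^ (-(λ_j + n - j + 1/2)))` with `1 ≤ i, j ≤ n`.

The arguments are `y`, a choice of square roots `y_i = x_i ^ (1/2)` of the variables, and `m`, the
doubled weight `m_j = 2 * λ_j` (so even entries stand for a partition and odd entries for a
half-partition); hence `x_i ^ (λ_j + n - j + 1/2) = y_i ^ (m_j + 2 * (n - j) + 1)`.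
As `j : Fin n` counts from `0`, the quantity `n - j` of the formula is `n - 1 - j` in the code. -/
def altDet {K : Type*} [Field K] {n : ℕ} (c : K) (m : Fin n → ℕ) (y : Fin n → K) : K :=
  Matrix.det (Matrix.of fun i j : Fin n =>
    y i ^ ((m j : ℤ) + 2 * ((n : ℤ) - 1 - (j : ℤ)) + 1)
      + c * y i ^ (-((m j : ℤ) + 2 * ((n : ℤ) - 1 - (j : ℤ)) + 1)))

/-- The odd-orthogonal Schur function `so_{2n+1,λ}(x)`, where `m = 2λ` and `y_i = x_i ^ (1/2)`. -/
def so {K : Type*} [Field K] {n : ℕ} (m : Fin n → ℕ) (y : Fin n → K) : K :=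
  altDet (-1) m y / altDet (-1) (fun _ => 0) y

/-- The companion `so⁺_{2n+1,λ}(x)`, where `m = 2λ` and `y_i = x_i ^ (1/2)`. -/
def soPlus {K : Type*} [Field K] {n : ℕ} (m : Fin n → ℕ) (y : Fin n → K) : K :=
  altDet 1 m y / altDet 1 (fun _ => 0) y

end OddOrthogonal

open Finset

/-! Expand each `altDet c` multilinearly in its rows: it becomes a signed sum, over the choices `e`
of `y_i` or `y_i⁻¹`, of ordinary alternants in `t_i = s_i ^ 2` with `s = invertAt e y`. For fixed
`e`, Macdonald's bounded Littlewood identity (`pairFactor_mul_sum_alternant`) sums these over the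
box. Its right side, `reciprocalDet (r + n) t`, is `altDet (-1) (r^n) s` up to a monomial, and
inverting an `s_i` only changes its sign. So the quotient of the `(r^n)` determinant by the `0`
determinant does not depend on `e`; it comes out of the sum as the first factor, and what remains
reassembles into `altDet c (r^n) y`. The parameter `ε` enters only through `c = -ε`
(`altDet_neg_one_sqrt_smul`). The bounded identity is proved by induction on `n` and `r`: both sides
satisfy the same recurrence, which for `reciprocalDet` reduces to a Lagrange interpolation identity.
-/

namespace OddOrthogonal

/-! ### An interpolation identity. -/

section Lagrange

variable {K ι : Type*} [Field K] [DecidableEq ι]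

open Polynomial in
-- The two products agree at `X = -1`, so `X + 1` divides their difference. Dividing the value at `x
-- i` by `x i + 1` would fail for `x i = -1`, so `g` is built recursively and its values are tracked
-- along the way.
theorem exists_polynomial_interpolating_reciprocal_products (s : Finset ι) (x : ι → K) :
    ∃ g : K[X], (X + 1) * g = ∏ i ∈ s, (X * C (x i) - 1) - ∏ i ∈ s, (X - C (x i)) ∧
      (∀ i ∈ s, g.eval (x i) = (x i - 1) * ∏ j ∈ s.erase i, (x i * x j - 1)) ∧
      g.degree < #s ∧ g.coeff (#s - 1) = ∏ i ∈ s, x i - 1 := by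
  induction s using Finset.induction_on with
  | empty => exact ⟨0, by simp, by simp, by simp, by simp⟩
  | insert a s ha ih =>
    obtain ⟨g, h1, h2, h3, h4⟩ := ih
    have hmon : (∏ i ∈ s, (X - C (x i))).Monic := monic_prod_of_monic _ _ fun i _ => monic_X_sub_C _
    have hnat : (∏ i ∈ s, (X - C (x i))).natDegree = #s := by
      rw [natDegree_prod_of_monic _ _ fun i _ => monic_X_sub_C _]; simp
    have hcoeff : (∏ i ∈ s, (X - C (x i))).coeff #s = 1 := by
      rw [← hnat]; exact hmon
    have hg : g.coeff #s = 0 := coeff_eq_zero_of_degree_lt h3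
    -- Multiplying by `X` avoids the truncated index `#s - 1` when `s` is empty.
    have hgs : (X * g).coeff #s = ∏ i ∈ s, x i - 1 := by
      rcases Nat.eq_zero_or_pos #s with h | h
      · rw [h, coeff_X_mul_zero]
        rw [card_eq_zero] at h
        simp [h]
      · obtain ⟨k, hk⟩ := Nat.exists_eq_succ_of_ne_zero h.ne'
        rw [hk, Nat.succ_eq_add_one, coeff_X_mul, ← h4, hk]; simp
    refine ⟨(X * C (x a) - 1) * g + C (x a - 1) * ∏ i ∈ s, (X - C (x i)), ?_, ?_, ?_, ?_⟩
    · rw [prod_insert ha, prod_insert ha, C_sub, C_1]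
      linear_combination (X * C (x a) - 1) * h1
    · intro i hi
      rcases mem_insert.mp hi with rfl | hi'
      · have := congrArg (eval (x i)) h1
        simp only [eval_mul, eval_add, eval_X, eval_one, eval_sub, eval_prod, eval_C] at this
        rw [erase_insert ha]
        simp only [eval_mul, eval_add, eval_X, eval_one, eval_sub, eval_prod, eval_C]
        linear_combination (x i - 1) * this
      · have hia : i ≠ a := by rintro rfl; exact ha hi'
        rw [erase_insert_of_ne hia.symm, prod_insert (by simp [ha])]
        simp only [eval_mul, eval_add, eval_X, eval_one, eval_sub, eval_prod, eval_C]
        rw [h2 i hi', prod_eq_zero hi' (sub_self (x i))]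
        ring
    · rw [card_insert_of_notMem ha, degree_lt_iff_coeff_zero]
      intro m hm
      have hm0 : g.coeff m = 0 :=
        coeff_eq_zero_of_degree_lt (h3.trans_le (by exact_mod_cast (by omega : #s ≤ m)))
      obtain ⟨k, rfl⟩ : ∃ k, m = k + 1 := ⟨m - 1, by omega⟩
      have hm1 : g.coeff k = 0 :=
        coeff_eq_zero_of_degree_lt (h3.trans_le (by exact_mod_cast (by omega : #s ≤ k)))
      have hm2 : (∏ i ∈ s, (X - C (x i))).coeff (k + 1) = 0 :=
        coeff_eq_zero_of_natDegree_lt (by omega)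
      rw [show (X * C (x a) - 1) * g = C (x a) * (X * g) - g by ring, coeff_add, coeff_sub,
        coeff_C_mul, coeff_C_mul, coeff_X_mul, hm0, hm1, hm2]
      ring
    · rw [card_insert_of_notMem ha, prod_insert ha, Nat.add_sub_cancel,
        show (X * C (x a) - 1) * g = C (x a) * (X * g) - g by ring, coeff_add, coeff_sub,
        coeff_C_mul, coeff_C_mul, hgs, hg, hcoeff]
      ring

theorem sum_sub_one_mul_prod_div (s : Finset ι) (x : ι → K) (hx : Set.InjOn x s) :
    ∑ i ∈ s, (x i - 1) * ∏ j ∈ s.erase i, ((x i * x j - 1) / (x i - x j)) = ∏ i ∈ s, x i - 1 := by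
  obtain ⟨g, -, h2, h3, h4⟩ := exists_polynomial_interpolating_reciprocal_products s x
  rw [← h4, Lagrange.coeff_eq_sum hx h3]
  refine sum_congr rfl fun i hi => ?_
  rw [h2 i hi, prod_div_distrib, mul_div_assoc]

end Lagrange

/-! ### Expansion of determinants into projective Vandermondes. -/

section Determinants

theorem prod_prod_Ioi_succAbove {R : Type*} [CommRing R] {n : ℕ}
    (g : Fin (n + 1) → Fin (n + 1) → R) (i : Fin (n + 1)) :
    ∏ a, ∏ b ∈ Ioi a, g a b =
      (∏ j : Fin n, if i < i.succAbove j then g i (i.succAbove j) else g (i.succAbove j) i) *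
        ∏ a : Fin n, ∏ b ∈ Ioi a, g (i.succAbove a) (i.succAbove b) := by
  have h : ∀ (m : ℕ) (f : Fin m → Fin m → R),
      ∏ a, ∏ b ∈ Ioi a, f a b = ∏ a, ∏ b, if a < b then f a b else 1 := by
    intro m f
    refine prod_congr rfl fun a _ => ?_
    rw [← prod_filter]
    congr 1
    ext; simp
  rw [h, h, Fin.prod_univ_succAbove _ i, Fin.prod_univ_succAbove _ i]
  simp_rw [Fin.prod_univ_succAbove _ i, Fin.succAbove_lt_succAbove_iff]
  rw [prod_mul_distrib, ← mul_assoc]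
  congr 1
  rw [if_neg (lt_irrefl i), one_mul, ← prod_mul_distrib]
  refine prod_congr rfl fun j _ => ?_
  rcases lt_or_gt_of_ne (Fin.succAbove_ne i j) with hlt | hlt
  · simp [hlt, hlt.not_gt]
  · simp [hlt, hlt.not_gt]

theorem prod_ite_lt_succAbove_neg_one {R : Type*} [CommRing R] {n : ℕ} (i : Fin (n + 1)) :
    (∏ j : Fin n, if i < i.succAbove j then (1 : R) else -1) = (-1) ^ (i : ℕ) := by
  rw [prod_ite, prod_const_one, one_mul, prod_const]
  congr 1
  have : (univ.filter fun j : Fin n => ¬ i < i.succAbove j) =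
      univ.filter fun j : Fin n => (j : ℕ) < i := by
    ext j
    simp only [mem_filter, mem_univ, true_and, not_lt]
    simp only [Fin.succAbove, Fin.le_def, Fin.lt_def]
    split_ifs <;> (simp_all; try omega)
  rw [this]
  rw [Fin.card_filter_val_lt]
  omega

variable {R : Type*} [CommRing R] {n : ℕ}

theorem det_sum_bool (w : Fin n → Bool → R) (M : Fin n → Bool → Fin n → R) :
    Matrix.det (Matrix.of fun i j => w i true * M i true j + w i false * M i false j) =
      ∑ e : Fin n → Bool, (∏ i, w i (e i)) * Matrix.det (Matrix.of fun i j => M i (e i) j) := by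
  have h := (Matrix.detRowAlternating (R := R) (n := Fin n)).toMultilinearMap.map_sum
    (fun i (b : Bool) => w i b • M i b)
  have h' : (Matrix.of fun i j => w i true * M i true j + w i false * M i false j) =
      fun i => ∑ b : Bool, w i b • M i b := by
    ext i j; simp
  rw [h']
  refine h.trans (sum_congr rfl fun e _ => ?_)
  exact (Matrix.detRowAlternating (R := R) (n := Fin n)).toMultilinearMap.map_smul_univ
    (fun i => w i (e i)) (fun i => M i (e i))

/-- The projective Vandermonde determinant with `i`-th point `[t i : 1]` or `[1 : t i]`. -/
def signedVandermonde (t : Fin n → R) (e : Fin n → Bool) : R :=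
  (Matrix.projVandermonde (fun i => if e i then 1 else t i)
    (fun i => if e i then t i else 1)).det

/-- Collect the Vandermonde factors involving `i`; each of the `i` earlier indices contributes a
sign. -/
theorem signedVandermonde_eq (t : Fin (n + 1) → R) (e : Fin (n + 1) → Bool) (i : Fin (n + 1))
    (hi : e i = true) :
    signedVandermonde t e = (-1) ^ (i : ℕ) *
      (∏ j : Fin n, if e (i.succAbove j) then t i - t (i.succAbove j)
        else t i * t (i.succAbove j) - 1) *
        signedVandermonde (i.removeNth t) (i.removeNth e) := by
  rw [signedVandermonde, Matrix.det_projVandermonde,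
    prod_prod_Ioi_succAbove (fun a b : Fin (n + 1) =>
      (if e b then 1 else t b) * (if e a then t a else 1) -
        (if e a then 1 else t a) * (if e b then t b else 1)) i,
    signedVandermonde, Matrix.det_projVandermonde, ← prod_ite_lt_succAbove_neg_one (R := R) i]
  refine congrArg₂ (· * ·) ?_ rfl
  rw [← prod_mul_distrib]
  refine Finset.prod_congr rfl fun j _ => ?_
  cases h : e (i.succAbove j) <;> simp only [hi] <;> split_ifs <;> simp_all <;> ring

/-- `det (t_i ^ (N + n - 1 - j) - t_i ^ j)` with `0 ≤ i, j < n`. -/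
def reciprocalDet (N : ℕ) (t : Fin n → R) : R :=
  Matrix.det (Matrix.of fun i j : Fin n => t i ^ (N + (j.rev : ℕ)) - t i ^ (j : ℕ))

theorem reciprocalDet_eq_sum (N : ℕ) (t : Fin n → R) :
    reciprocalDet N t = ∑ e : Fin n → Bool,
      (∏ i, if e i then t i ^ N else -1) * signedVandermonde t e := by
  have := det_sum_bool (fun i b => if b then t i ^ N else -1)
    (fun i b j => (if b then 1 else t i) ^ (j : ℕ) * (if b then t i else 1) ^ (j.rev : ℕ))
  refine Eq.trans ?_ this
  rw [reciprocalDet]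
  congr 1
  ext i j
  simp [pow_add, sub_eq_add_neg]

end Determinants

/-! ### The recurrence in `N` for `reciprocalDet`. -/

section Recurrence

variable {K : Type*} [Field K] {n : ℕ}

/-- The quotients turn the factors `t i - t j` with `e j = true` into `t i * t j - 1`, the form
already taken when `e j = false`; the product then no longer depends on `e`. -/
theorem signedVandermonde_mul_prod (t : Fin (n + 1) → K) (ht : Function.Injective t)
    (e : Fin (n + 1) → Bool) (i : Fin (n + 1)) (hi : e i = true) :
    (∏ j ∈ (univ.filter fun a => e a = true).erase i, ((t i * t j - 1) / (t i - t j))) *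
        signedVandermonde t e =
      (-1) ^ (i : ℕ) * (∏ j : Fin n, (t i * t (i.succAbove j) - 1)) *
        signedVandermonde (i.removeNth t) (i.removeNth e) := by
  have h : ∏ j ∈ (univ.filter fun a => e a = true).erase i, ((t i * t j - 1) / (t i - t j)) =
      ∏ j : Fin n, if e (i.succAbove j) then
        (t i * t (i.succAbove j) - 1) / (t i - t (i.succAbove j)) else 1 := by
    rw [show (univ.filter fun a => e a = true).erase i =
      univ.filter fun a => a ≠ i ∧ e a = true by ext; simp, prod_filter,
      Fin.prod_univ_succAbove _ i]
    simp [Fin.succAbove_ne]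
  rw [h, signedVandermonde_eq t e i hi]
  have h2 : ∏ j : Fin n, (t i * t (i.succAbove j) - 1) =
      (∏ j : Fin n, if e (i.succAbove j) then
        (t i * t (i.succAbove j) - 1) / (t i - t (i.succAbove j)) else 1) *
      ∏ j : Fin n, if e (i.succAbove j) then t i - t (i.succAbove j)
        else t i * t (i.succAbove j) - 1 := by
    rw [← prod_mul_distrib]
    refine prod_congr rfl fun j _ => ?_
    have : t i - t (i.succAbove j) ≠ 0 :=
      sub_ne_zero.mpr fun h => Fin.succAbove_ne i j (ht h).symm
    split_ifs
    · field_simp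
    · rw [one_mul]
  rw [h2]
  ring

theorem sum_signedVandermonde_removeNth (t : Fin (n + 1) → K) (ht : Function.Injective t)
    (e : Fin (n + 1) → Bool) :
    ∑ i, (if e i then (t i - 1) * ((-1) ^ (i : ℕ) * (∏ j : Fin n, (t i * t (i.succAbove j) - 1)) *
        signedVandermonde (i.removeNth t) (i.removeNth e)) else 0) =
      ((∏ i, if e i then t i else 1) - 1) * signedVandermonde t e := by
  rw [← sum_filter, ← prod_filter, ← sum_sub_one_mul_prod_div _ t ht.injOn, sum_mul]
  refine sum_congr rfl fun i hi => ?_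
  rw [mul_assoc (t i - 1), signedVandermonde_mul_prod t ht e i (by simpa using hi)]

/-- Expanding over `e`, raising `N` by one multiplies the term of `e` by the product of the `t i`
with `e i = true`. The interpolation identity on that set of indices rewrites the increment as a sum
over removed variables. -/
theorem reciprocalDet_succ (t : Fin (n + 1) → K) (ht : Function.Injective t) (N : ℕ) :
    reciprocalDet (N + 1) t = reciprocalDet N t +
      ∑ i : Fin (n + 1), (-1) ^ (i : ℕ) * t i ^ N *
        ((t i - 1) * ∏ j : Fin n, (t i * t (i.succAbove j) - 1)) *
        reciprocalDet N (i.removeNth t) := by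
  have h1 : ∀ i : Fin (n + 1), (-1) ^ (i : ℕ) * t i ^ N *
      ((t i - 1) * ∏ j : Fin n, (t i * t (i.succAbove j) - 1)) *
        reciprocalDet N (i.removeNth t) =
      ∑ e : Fin (n + 1) → Bool, (∏ a, if e a then t a ^ N else -1) *
        (if e i then (t i - 1) * ((-1) ^ (i : ℕ) * (∏ j : Fin n, (t i * t (i.succAbove j) - 1)) *
        signedVandermonde (i.removeNth t) (i.removeNth e)) else 0) := by
    intro i
    -- Sign choices for the other `n` variables correspond to those `e` with `e i = true`; the rest
    -- contribute zero.
    rw [← (Fin.insertNthEquiv (fun _ => Bool) i).sum_comp, Fintype.sum_prod_type,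
      Fintype.sum_bool, reciprocalDet_eq_sum, mul_sum]
    simp only [Fin.insertNthEquiv_apply, Fin.insertNth_apply_same, Fin.prod_univ_succAbove _ i,
      Fin.insertNth_apply_succAbove, if_true, Bool.false_eq_true, if_false, mul_zero,
      sum_const_zero, add_zero]
    refine sum_congr rfl fun e _ => ?_
    rw [show i.removeNth (Fin.insertNthEquiv (fun _ => Bool) i (true, e)) = e from
      Fin.removeNth_insertNth (α := fun _ => Bool) i true e]
    simp only [Fin.removeNth]
    ring
  simp_rw [h1]
  rw [sum_comm]
  simp_rw [← mul_sum, sum_signedVandermonde_removeNth t ht]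
  rw [reciprocalDet_eq_sum, reciprocalDet_eq_sum, ← sum_add_distrib]
  refine sum_congr rfl fun e _ => ?_
  have : (∏ a, if e a then t a ^ (N + 1) else -1) =
      (∏ a, if e a then t a ^ N else -1) * ∏ a, if e a then t a else 1 := by
    rw [← prod_mul_distrib]
    exact prod_congr rfl fun a _ => by split_ifs <;> ring
  rw [this]
  ring

/-- With `n + 1` variables this plays the role of `r = -1`, the empty box, and starts the
recurrence. -/
theorem reciprocalDet_eq_zero (t : Fin (n + 1) → K) : reciprocalDet n t = 0 := by
  refine Matrix.det_eq_zero_of_column_eq_zero (Fin.last n) fun i => ?_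
  simp

end Recurrence

/-! ### The bounded Littlewood identity. -/

section Littlewood

theorem mem_partitionsInBox {n r : ℕ} {lam : Fin n → ℕ} :
    lam ∈ partitionsInBox n r ↔ (∀ i, lam i ≤ r) ∧ Antitone lam := by
  simp [partitionsInBox]

theorem antitone_cons_of_le {n r : ℕ} {mu : Fin n → ℕ} (h : ∀ i, mu i ≤ r) (hmu : Antitone mu) :
    Antitone (Fin.cons r mu : Fin (n + 1) → ℕ) := by
  intro a b hab
  induction a using Fin.cases with
  | zero => induction b using Fin.cases with
    | zero => simp
    | succ b => simpa using h b
  | succ a => induction b using Fin.cases with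
    | zero => exact absurd hab (by simp)
    | succ b => simpa using hmu (Fin.succ_le_succ_iff.mp hab)

theorem sum_partitionsInBox_succ {M : Type*} [AddCommMonoid M] (n r : ℕ)
    (f : (Fin (n + 1) → ℕ) → M) :
    ∑ lam ∈ partitionsInBox (n + 1) (r + 1), f lam =
      ∑ lam ∈ partitionsInBox (n + 1) r, f lam +
        ∑ mu ∈ partitionsInBox n (r + 1), f (Fin.cons (r + 1) mu) := by
  rw [← sum_filter_not_add_sum_filter _ (fun lam : Fin (n + 1) → ℕ => lam 0 = r + 1)]
  congr 1
  · refine sum_congr ?_ fun _ _ => rfl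
    ext lam
    simp only [mem_filter, mem_partitionsInBox]
    constructor
    · rintro ⟨⟨h1, h2⟩, h3⟩
      refine ⟨fun i => ?_, h2⟩
      have := h2 (Fin.zero_le i)
      have := h1 0
      omega
    · rintro ⟨h1, h2⟩
      exact ⟨⟨fun i => (h1 i).trans (Nat.le_succ r), h2⟩, fun h => by have := h1 0; omega⟩
  · refine sum_nbij' (fun lam => Fin.tail lam) (fun mu => Fin.cons (r + 1) mu) ?_ ?_ ?_ ?_ ?_
    · intro lam h
      simp only [mem_filter, mem_partitionsInBox] at h ⊢
      exact ⟨fun i => h.1.1 _, fun a b hab => h.1.2 (Fin.succ_le_succ_iff.mpr hab)⟩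
    · intro mu h
      simp only [mem_filter, mem_partitionsInBox] at h ⊢
      refine ⟨⟨fun i => ?_, antitone_cons_of_le h.1 h.2⟩, by simp⟩
      induction i using Fin.cases with
      | zero => simp
      | succ i => simpa using h.1 i
    · intro lam h
      rw [← (mem_filter.mp h).2]
      exact Fin.cons_self_tail lam
    · intro mu _
      exact Fin.tail_cons _ _
    · intro lam h
      rw [← (mem_filter.mp h).2, Fin.cons_self_tail lam]

theorem partitionsInBox_zero_left (r : ℕ) : partitionsInBox 0 r = {Fin.elim0} := by
  ext lam
  simp [mem_partitionsInBox, eq_iff_true_of_subsingleton, Subsingleton.antitone]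

theorem partitionsInBox_zero_right (n : ℕ) : partitionsInBox n 0 = {fun _ => 0} := by
  ext lam
  simp only [mem_partitionsInBox, mem_singleton, Nat.le_zero]
  exact ⟨fun h => funext h.1, by rintro rfl; exact ⟨fun _ => rfl, antitone_const⟩⟩

variable {K : Type*} [Field K] {n : ℕ}

/-- The alternant `det (t_i ^ (λ_j + n - j))`, with `1 ≤ i, j ≤ n`. -/
def alternant (lam : Fin n → ℕ) (t : Fin n → K) : K :=
  Matrix.det (Matrix.of fun i j : Fin n => t i ^ (lam j + (j.rev : ℕ)))

theorem alternant_cons (a : ℕ) (mu : Fin n → ℕ) (t : Fin (n + 1) → K) :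
    alternant (Fin.cons a mu) t =
      ∑ i : Fin (n + 1), (-1) ^ (i : ℕ) * t i ^ (a + n) * alternant mu (i.removeNth t) := by
  rw [alternant, Matrix.det_succ_column_zero]
  refine sum_congr rfl fun i _ => ?_
  rw [alternant]
  refine congrArg₂ (· * ·) (by simp) (congrArg Matrix.det ?_)
  ext a b
  simp [Fin.removeNth]

theorem alternant_zero_eq (t : Fin n → K) :
    alternant (fun _ => 0) t = ∏ i, ∏ j ∈ Ioi i, (t i - t j) := by
  have := Matrix.det_projVandermonde (fun _ => 1) t
  simp only [one_mul] at this
  rw [← this, alternant]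
  congr 1
  ext i j
  simp [Matrix.projVandermonde_apply]

/-- `∏ i, (t_i - 1) * ∏ i < j, (t_i t_j - 1)`. -/
def pairFactor (t : Fin n → K) : K :=
  (∏ i, (t i - 1)) * ∏ i, ∏ j ∈ Ioi i, (t i * t j - 1)

theorem pairFactor_succAbove (t : Fin (n + 1) → K) (i : Fin (n + 1)) :
    pairFactor t =
      (t i - 1) * (∏ j : Fin n, (t i * t (i.succAbove j) - 1)) * pairFactor (i.removeNth t) := by
  rw [pairFactor, pairFactor, prod_prod_Ioi_succAbove (fun a b => t a * t b - 1) i,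
    Fin.prod_univ_succAbove _ i]
  simp only [mul_comm (t (i.succAbove _)) (t i), ite_self]
  simp only [Fin.removeNth]
  ring

theorem pairFactor_mul_alternant_zero (t : Fin n → K) (ht : Function.Injective t) :
    pairFactor t * alternant (fun _ => 0) t = reciprocalDet n t := by
  induction n with
  | zero => simp [pairFactor, alternant, reciprocalDet]
  | succ n ih =>
    have h0 : (fun _ => 0 : Fin (n + 1) → ℕ) = Fin.cons 0 fun _ => 0 := by
      ext i; induction i using Fin.cases <;> simp
    rw [h0, alternant_cons, reciprocalDet_succ t ht, reciprocalDet_eq_zero, mul_sum]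
    simp only [zero_add]
    refine sum_congr rfl fun i _ => ?_
    rw [← ih (i.removeNth t) (ht.comp Fin.succAbove_right_injective), pairFactor_succAbove t i]
    ring

/-- Macdonald's bounded version of Littlewood's identity. -/
theorem pairFactor_mul_sum_alternant (r : ℕ) (t : Fin n → K) (ht : Function.Injective t) :
    pairFactor t * ∑ lam ∈ partitionsInBox n r, alternant lam t = reciprocalDet (r + n) t := by
  induction n generalizing r with
  | zero => simp [partitionsInBox_zero_left, pairFactor, alternant, reciprocalDet]
  | succ n ihn =>
    induction r with
    | zero =>
      rw [partitionsInBox_zero_right, sum_singleton, zero_add,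
        pairFactor_mul_alternant_zero t ht]
    | succ r ihr =>
      -- Partitions with first part below `r + 1` give `reciprocalDet` at the previous `N`; those
      -- with first part `r + 1` give the recurrence's sum, by expansion along the first column.
      rw [sum_partitionsInBox_succ, mul_add, ihr, show r + 1 + (n + 1) = r + (n + 1) + 1 by ring,
        reciprocalDet_succ t ht]
      congr 1
      simp_rw [alternant_cons]
      rw [sum_comm, mul_sum]
      refine sum_congr rfl fun i _ => ?_
      rw [← mul_sum, show r + (n + 1) = r + 1 + n by ring,
        ← ihn (r + 1) (i.removeNth t) (ht.comp Fin.succAbove_right_injective),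
        pairFactor_succAbove t i]
      ring

end Littlewood

/-! ### From alternants to odd orthogonal determinants. -/

section AlternatingDeterminants

variable {K : Type*} [Field K] {n : ℕ}

theorem altDet_eq (c : K) (m : Fin n → ℕ) (y : Fin n → K) :
    altDet c m y = Matrix.det (Matrix.of fun i j : Fin n =>
      y i ^ (m j + 2 * (j.rev : ℕ) + 1) + c * (y i)⁻¹ ^ (m j + 2 * (j.rev : ℕ) + 1)) := by
  rw [altDet]
  congr 1
  ext i j
  have h : (m j : ℤ) + 2 * ((n : ℤ) - 1 - (j : ℤ)) + 1 =
      ((m j + 2 * (j.rev : ℕ) + 1 : ℕ) : ℤ) := by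
    rw [Fin.val_rev]
    have := j.2
    omega
  simp only [Matrix.of_apply, h, zpow_neg, zpow_natCast, inv_pow]

/-- The family `y_i ^ (± 1)`, with the signs prescribed by `e`. -/
def invertAt (e : Fin n → Bool) (y : Fin n → K) (i : Fin n) : K :=
  if e i then y i else (y i)⁻¹

theorem altDet_eq_sum (c : K) (m : Fin n → ℕ) (y : Fin n → K) :
    altDet c m y = ∑ e : Fin n → Bool, (∏ i, if e i then 1 else c) *
      Matrix.det (Matrix.of fun i j : Fin n =>
        invertAt e y i ^ (m j + 2 * (j.rev : ℕ) + 1)) := by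
  have := det_sum_bool (fun (_ : Fin n) b => if b then 1 else c)
    (fun i b j => (if b then y i else (y i)⁻¹) ^ (m j + 2 * (j.rev : ℕ) + 1))
  refine Eq.trans ?_ this
  rw [altDet_eq]
  simp

theorem det_pow_eq_alternant (a : ℕ) (lam : Fin n → ℕ) (s : Fin n → K) :
    Matrix.det (Matrix.of fun i j : Fin n => s i ^ (a + 2 * lam j + 2 * (j.rev : ℕ) + 1)) =
      (∏ i, s i ^ (a + 1)) * alternant lam fun i => s i ^ 2 := by
  rw [alternant, ← Matrix.det_mul_column]
  congr 1
  ext i j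
  simp only [Matrix.of_apply, ← pow_mul, ← pow_add]
  congr 1
  ring

theorem altDet_neg_one_mul_prod (r : ℕ) (s : Fin n → K) (hs : ∀ i, s i ≠ 0) :
    (∏ i, s i ^ (r + 2 * n)) * altDet (-1) (fun _ => r) s =
      (∏ i, s i) * reciprocalDet (r + n) fun i => s i ^ 2 := by
  rw [altDet_eq, reciprocalDet, ← Matrix.det_mul_column, ← Matrix.det_mul_column]
  congr 1
  ext i j
  simp only [Matrix.of_apply]
  -- The row factor `s i ^ (r + 2 * n)` clears all negative powers and leaves one common `s i`.
  have h : r + 2 * n = (r + 2 * (j.rev : ℕ) + 1) + (2 * (j : ℕ) + 1) := by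
    rw [Fin.val_rev]
    have := j.2
    omega
  have h1 : s i ^ (r + 2 * n) * (s i)⁻¹ ^ (r + 2 * (j.rev : ℕ) + 1) = s i ^ (2 * (j : ℕ) + 1) := by
    rw [h, pow_add, mul_right_comm, ← mul_pow, mul_inv_cancel₀ (hs i), one_pow, one_mul]
  have h2 : s i ^ (r + 2 * n) * s i ^ (r + 2 * (j.rev : ℕ) + 1) =
      s i * (s i ^ 2) ^ (r + n + (j.rev : ℕ)) := by
    ring
  linear_combination h2 - h1

theorem altDet_neg_one_invertAt (m : Fin n → ℕ) (y : Fin n → K) (e : Fin n → Bool) :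
    altDet (-1) m (invertAt e y) = (∏ i, if e i then 1 else -1) * altDet (-1) m y := by
  rw [altDet_eq, altDet_eq, ← Matrix.det_mul_column]
  congr 1
  ext i j
  simp only [Matrix.of_apply, invertAt]
  split_ifs
  · ring
  · rw [inv_inv]; ring

theorem altDet_neg_one_zero_ne_zero (s : Fin n → K) (hs : ∀ i, s i ≠ 0) (hs1 : ∀ i, s i ^ 2 ≠ 1)
    (hss : ∀ i j, i ≠ j → s i ^ 2 ≠ s j ^ 2) (hss1 : ∀ i j, i ≠ j → s i ^ 2 * s j ^ 2 ≠ 1) :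
    altDet (-1) (fun _ => 0) s ≠ 0 := by
  intro h0
  have h := altDet_neg_one_mul_prod 0 s hs
  have hinj : Function.Injective fun i => s i ^ 2 := fun i j h => by
    by_contra hij; exact hss i j hij h
  rw [h0, mul_zero, zero_add, ← pairFactor_mul_alternant_zero _ hinj, alternant_zero_eq,
    pairFactor] at h
  refine mul_ne_zero (prod_ne_zero_iff.mpr fun i _ => hs i) (mul_ne_zero (mul_ne_zero
    (prod_ne_zero_iff.mpr fun i _ => sub_ne_zero.mpr (hs1 i)) ?_) ?_) h.symm
  · exact prod_ne_zero_iff.mpr fun i _ => prod_ne_zero_iff.mpr fun j hj =>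
      sub_ne_zero.mpr (hss1 i j (mem_Ioi.mp hj).ne)
  · exact prod_ne_zero_iff.mpr fun i _ => prod_ne_zero_iff.mpr fun j hj =>
      sub_ne_zero.mpr (hss i j (mem_Ioi.mp hj).ne)

/-- Cross-multiplying the cases `0` and `r` eliminates `pairFactor` without dividing by it. -/
theorem altDet_zero_mul_sum_alternant (r : ℕ) (s : Fin n → K) (hs : ∀ i, s i ≠ 0)
    (hinj : Function.Injective fun i => s i ^ 2) :
    altDet (-1) (fun _ => 0) s * ∑ lam ∈ partitionsInBox n r, alternant lam (fun i => s i ^ 2) =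
      altDet (-1) (fun _ => r) s * ((∏ i, s i ^ r) * alternant (fun _ => 0) fun i => s i ^ 2) := by
  have hne : ∏ i, s i ^ (0 + 2 * n) ≠ 0 := prod_ne_zero_iff.mpr fun i _ => pow_ne_zero _ (hs i)
  refine mul_left_cancel₀ hne ?_
  have h0 := altDet_neg_one_mul_prod 0 s hs
  have hr := altDet_neg_one_mul_prod r s hs
  simp only [zero_add] at h0
  rw [← pairFactor_mul_alternant_zero _ hinj] at h0
  rw [← pairFactor_mul_sum_alternant _ _ hinj] at hr
  have hp : ∏ i, s i ^ (r + 2 * n) = (∏ i, s i ^ (2 * n)) * ∏ i, s i ^ r := by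
    rw [← prod_mul_distrib]; exact prod_congr rfl fun i _ => by ring
  rw [hp] at hr
  simp only [zero_add]
  linear_combination (∑ lam ∈ partitionsInBox n r, alternant lam (fun i => s i ^ 2)) * h0 -
    alternant (fun _ => 0) (fun i => s i ^ 2) * hr

theorem invertAt_sq_injective (y : Fin n → K) (hy : ∀ i, y i ≠ 0)
    (hyy : ∀ i j, i ≠ j → y i ^ 2 ≠ y j ^ 2) (hyy1 : ∀ i j, i ≠ j → y i ^ 2 * y j ^ 2 ≠ 1)
    (e : Fin n → Bool) : Function.Injective fun i => invertAt e y i ^ 2 := by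
  intro i j h
  by_contra hij
  have hi := pow_ne_zero 2 (hy i)
  have hj := pow_ne_zero 2 (hy j)
  simp only [invertAt] at h
  split_ifs at h
  · exact hyy i j hij h
  · exact hyy1 i j hij (by rw [h, inv_pow, inv_mul_cancel₀ hj])
  · exact hyy1 i j hij (by rw [← h, inv_pow, mul_inv_cancel₀ hi])
  · exact hyy i j hij (by simpa using h)

theorem altDet_zero_mul_sum_altDet (r : ℕ) (c : K) (y : Fin n → K) (hy : ∀ i, y i ≠ 0)
    (hyy : ∀ i j, i ≠ j → y i ^ 2 ≠ y j ^ 2) (hyy1 : ∀ i j, i ≠ j → y i ^ 2 * y j ^ 2 ≠ 1) :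
    altDet (-1) (fun _ => 0) y * ∑ lam ∈ partitionsInBox n r, altDet c (fun i => 2 * lam i) y =
      altDet (-1) (fun _ => r) y * altDet c (fun _ => r) y := by
  have hl : ∀ lam : Fin n → ℕ, altDet c (fun i => 2 * lam i) y = ∑ e : Fin n → Bool,
      (∏ i, if e i then 1 else c) * ((∏ i, invertAt e y i) *
        alternant lam fun i => invertAt e y i ^ 2) := by
    intro lam
    rw [altDet_eq_sum]
    refine sum_congr rfl fun e _ => ?_
    have := det_pow_eq_alternant 0 lam (invertAt e y)
    simp only [zero_add, pow_one] at this
    rw [this]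
  have hr : altDet c (fun _ => r) y = ∑ e : Fin n → Bool,
      (∏ i, if e i then 1 else c) * ((∏ i, invertAt e y i) * ((∏ i, invertAt e y i ^ r) *
        alternant (fun _ => 0) fun i => invertAt e y i ^ 2)) := by
    rw [altDet_eq_sum]
    refine sum_congr rfl fun e _ => ?_
    have := det_pow_eq_alternant r (fun _ => 0) (invertAt e y)
    simp only [mul_zero, add_zero] at this
    rw [this, ← mul_assoc (∏ i, invertAt e y i), ← prod_mul_distrib]
    simp only [pow_succ']
  simp_rw [hl]
  rw [sum_comm, hr, mul_sum, mul_sum]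
  refine sum_congr rfl fun e _ => ?_
  have hne : ∀ i, invertAt e y i ≠ 0 := fun i => by
    rw [invertAt]; split_ifs
    · exact hy i
    · exact inv_ne_zero (hy i)
  have h := altDet_zero_mul_sum_alternant r _ hne (invertAt_sq_injective y hy hyy hyy1 e)
  have hsign : (∏ i, if e i then 1 else (-1 : K)) ≠ 0 := prod_ne_zero_iff.mpr fun i _ => by
    split_ifs <;> simp
  rw [altDet_neg_one_invertAt, altDet_neg_one_invertAt, mul_assoc, mul_assoc] at h
  rw [← mul_sum, ← mul_sum]
  linear_combination (∏ i, if e i then 1 else c) * (∏ i, invertAt e y i) *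
    mul_left_cancel₀ hsign h

/-- For an odd exponent `2k + 1`, `z_i` contributes `ε ^ k * (z_i / y_i)` times the power of `y_i`;
for the inverse power there is one more `ε`, since `z_i⁻¹ = ε * z_i / y_i ^ 2`. Hence `-1` becomes
`-ε`, and the rest are row and column factors, whatever the choice of roots. -/
theorem altDet_neg_one_sqrt_smul (ε : K) (hε : ε * ε = 1) (lam : Fin n → ℕ) (y z : Fin n → K)
    (hy : ∀ i, y i ≠ 0) (hyz : ∀ i, z i ^ 2 = ε * y i ^ 2) :
    altDet (-1) (fun i => 2 * lam i) z =
      ε ^ (∑ i, lam i) * ((∏ j : Fin n, ε ^ (j.rev : ℕ)) * ∏ i, z i * (y i)⁻¹) *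
        altDet (-ε) (fun i => 2 * lam i) y := by
  rw [← prod_pow_eq_pow_sum, ← mul_assoc, ← prod_mul_distrib, mul_assoc, altDet_eq, altDet_eq,
    ← Matrix.det_mul_column, ← Matrix.det_mul_row]
  congr 1
  ext i j
  have hε0 : ε ≠ 0 := left_ne_zero_of_mul_eq_one hε
  have hz : z i ≠ 0 := by
    intro h
    have := hyz i
    rw [h, zero_pow two_ne_zero, eq_comm, mul_eq_zero] at this
    exact this.elim hε0 (pow_ne_zero 2 (hy i))
  have hinv : (z i)⁻¹ = ε * (z i * ((y i)⁻¹ * (y i)⁻¹)) := by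
    have := hyz i
    have h1 := hy i
    field_simp
    linear_combination -(hε * y i ^ 2) - ε * hyz i
  have h1 : z i ^ (2 * lam j + 2 * (j.rev : ℕ) + 1) =
      ε ^ (lam j + (j.rev : ℕ)) * (z i * (y i)⁻¹ *
        y i ^ (2 * lam j + 2 * (j.rev : ℕ) + 1)) := by
    have h1 := hy i
    rw [show 2 * lam j + 2 * (j.rev : ℕ) + 1 = 2 * (lam j + (j.rev : ℕ)) + 1 by ring,
      pow_succ _ (2 * _), pow_mul, hyz, pow_succ _ (2 * _), pow_mul, mul_pow]
    field_simp
  have h2 : (z i)⁻¹ ^ (2 * lam j + 2 * (j.rev : ℕ) + 1) =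
      ε ^ (lam j + (j.rev : ℕ)) * (z i * (y i)⁻¹ *
        (ε * (y i)⁻¹ ^ (2 * lam j + 2 * (j.rev : ℕ) + 1))) := by
    have hinv2 : (z i)⁻¹ ^ 2 = ε * (y i)⁻¹ ^ 2 := by
      rw [inv_pow, hyz, mul_inv, inv_pow, inv_eq_of_mul_eq_one_left hε]
    rw [show 2 * lam j + 2 * (j.rev : ℕ) + 1 = 2 * (lam j + (j.rev : ℕ)) + 1 by ring,
      pow_succ _ (2 * _), pow_mul, hinv2, pow_succ _ (2 * _), pow_mul, mul_pow, hinv]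
    ring
  simp only [Matrix.of_apply]
  rw [h1, h2]
  ring

end AlternatingDeterminants

end OddOrthogonal

open OddOrthogonal in
theorem theorem4p1 {K : Type*} [Field K] (n r : ℕ) (ε : ℤ) (hε : ε = 1 ∨ ε = -1)
    (x y z : Fin n → K)
    (hy : ∀ i, y i ^ 2 = x i) (hz : ∀ i, z i ^ 2 = (ε : K) * x i)
    (hx0 : ∀ i, x i ≠ 0) (hx1 : ∀ i, x i ≠ 1) (hxε : ∀ i, x i ≠ (ε : K))
    (hxx : ∀ i j, i ≠ j → x i ≠ x j) (hxx1 : ∀ i j, i ≠ j → x i * x j ≠ 1) :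
    OddOrthogonal.altDet (-1) (fun _ => 0) z ≠ 0 ∧
    OddOrthogonal.altDet (-1) (fun _ => 0) y ≠ 0 ∧
    OddOrthogonal.altDet (-(ε : K)) (fun _ => 0) y ≠ 0 ∧
    ∑ lam ∈ OddOrthogonal.partitionsInBox n r,
        (ε : K) ^ (∑ i, lam i) * OddOrthogonal.so (fun i => 2 * lam i) z =
      OddOrthogonal.so (fun _ => r) y *
        (if ε = 1 then OddOrthogonal.so (fun _ => r) y
          else OddOrthogonal.soPlus (fun _ => r) y) := by
  have hεε : (ε : K) * ε = 1 := by rcases hε with rfl | rfl <;> simp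
  have hε0 : (ε : K) ≠ 0 := left_ne_zero_of_mul_eq_one hεε
  have hy0 : ∀ i, y i ≠ 0 := fun i h => hx0 i (by rw [← hy, h, zero_pow two_ne_zero])
  have hz0 : ∀ i, z i ≠ 0 := fun i h => mul_ne_zero hε0 (hx0 i)
    (by rw [← hz, h, zero_pow two_ne_zero])
  have hDz : altDet (-1) (fun _ => 0) z ≠ 0 := by
    refine altDet_neg_one_zero_ne_zero z hz0 ?_ ?_ ?_
    · intro i h
      rw [hz] at h
      exact hxε i (by linear_combination (ε : K) * h - x i * hεε)
    · intro i j hij h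
      rw [hz, hz] at h
      exact hxx i j hij (mul_left_cancel₀ hε0 h)
    · intro i j hij h
      rw [hz, hz] at h
      exact hxx1 i j hij (by linear_combination h - x i * x j * hεε)
  have hDy : altDet (-1) (fun _ => 0) y ≠ 0 :=
    altDet_neg_one_zero_ne_zero y hy0 (by simpa [hy] using hx1) (by simpa [hy] using hxx)
      (by simpa [hy] using hxx1)
  have hzy := fun lam => altDet_neg_one_sqrt_smul (ε : K) hεε lam y z hy0
    (fun i => by rw [hz, hy])
  have hD : altDet (-1) (fun _ => 0) z =
      ((∏ j : Fin n, (ε : K) ^ (j.rev : ℕ)) * ∏ i, z i * (y i)⁻¹) *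
        altDet (-(ε : K)) (fun _ => 0) y := by
    simpa using hzy fun _ => 0
  -- Nonvanishing of the `so⁺` denominator is inherited from the variables `ε x_i`, which is where
  -- `x_i ≠ ε` enters.
  have hDε : altDet (-(ε : K)) (fun _ => 0) y ≠ 0 := right_ne_zero_of_mul (hD ▸ hDz)
  have hA := left_ne_zero_of_mul (hD ▸ hDz)
  refine ⟨hDz, hDy, hDε, ?_⟩
  have hso : ∀ lam : Fin n → ℕ, (ε : K) ^ (∑ i, lam i) * so (fun i => 2 * lam i) z =
      altDet (-(ε : K)) (fun i => 2 * lam i) y / altDet (-(ε : K)) (fun _ => 0) y := by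
    intro lam
    have hpow : (ε : K) ^ (∑ i, lam i) * (ε : K) ^ (∑ i, lam i) = 1 := by
      rw [← mul_pow, hεε, one_pow]
    rw [so, hzy, hD, mul_assoc ((ε : K) ^ _), mul_div_assoc, ← mul_assoc, hpow, one_mul,
      mul_div_mul_left _ _ hA]
  have hright : (if ε = 1 then so (fun _ => r) y else soPlus (fun _ => r) y) =
      altDet (-(ε : K)) (fun _ => r) y / altDet (-(ε : K)) (fun _ => 0) y := by
    rcases hε with rfl | rfl
    · simp [so]
    · rw [if_neg (by decide)]
      simp [soPlus]
  have key := altDet_zero_mul_sum_altDet r (-(ε : K)) y hy0 (by simpa [hy] using hxx)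
    (by simpa [hy] using hxx1)
  simp_rw [hso]
  rw [hright, ← sum_div, so, div_mul_div_comm, ← key, mul_div_mul_left _ _ hDy]
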